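/- Let $\mathbb X\subset\mathbb R^m$, $\mathbb Y\subset\mathbb R^n$ be Borel sets and $\mathbb U\subset\mathbb R^k$ a compact set. Let $P$ be a probability measure on $\mathbb X$, $Q$ a stochastic kernel from $\mathbb X$ to $\mathbb Y$, $\beta\in(0,1)$, and $c:\mathbb X\times\mathbb U\to\mathbb R$. An admissible policy $\gamma=(\gamma_t)_{t\ge 0}\in\Gamma$ is a sequence of measurable maps giving the actions $U_t=\gamma_t(Y_0,\dots,Y_t,U_0,\dots,U_{t-1})\in\mathbb U$. For a stochastic kernel $\mathcal S$ from $\mathbb X\times\mathbb U$ to $\mathbb X$, let $E_P^{\mathcal S,\gamma}$ be the expectation for the process in which $X_0\sim P$, $Y_t\sim Q(\cdot|X_t)$, $U_t$ is given by $\gamma$, and $X_{t+1}\sim\mathcal S(\cdot|X_t,U_t)$ (each conditionally on the past), and put $$J_\beta(P,\mathcal S,\gamma)=E_P^{\mathcal S,\gamma}\Big[\sum_{t=0}^\infty\beta^t c(X_t,U_t)\Big],\qquad J_\beta^*(P,\mathcal S)=\inf_{\gamma\in\Gamma}J_\beta(P,\mathcal S,\gamma).$$ Let $\mathcal T$ and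 $\mathcal T_i$ $(i\in\mathbb N)$ be stochastic kernels from $\mathbb X\times\mathbb U$ to $\mathbb X$. Assume: (a) $\mathcal T(\cdot|x,u)$ is weakly continuous in $(x,u)$; (b) $Q$ is continuous in total variation: if $x_j\to x$ in $\mathbb X$, then $Q(\cdot|x_j)\to Q(\cdot|x)$ in total variation; (c) $c$ is non-negative, bounded and continuous on $\mathbb X\times\mathbb U$; (d) $\mathcal T_i(\cdot|x_i,u_i)\to\mathcal T(\cdot|x,u)$ weakly whenever $(x_i,u_i)\to(x,u)$ in $\mathbb X\times\mathbb U$. For each $i$ let $\gamma_i^*\in\Gamma$ be an optimal policy for $\mathcal T_i$, that is, $J_\beta(P,\mathcal T_i,\gamma_i^*)=J_\beta^*(P,\mathcal T_i)$. Then $$\lim_{i\to\infty}\big|J_\beta(P,\mathcal T,\gamma_i^*)-J_\beta^*(P,\mathcal T)\big|=0.$$ -/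

import Mathlib

open MeasureTheory ProbabilityTheory Filter Topology
open scoped BoundedContinuousFunction

noncomputable section

namespace RobustPOMDP

/-- Weak convergence of a sequence of measures: convergence of the integrals of all
bounded continuous real functions. -/
def WeaklyConverges {S : Type*} [TopologicalSpace S] [MeasurableSpace S]
    (μs : ℕ → Measure S) (μ : Measure S) : Prop :=
  ∀ f : S →ᵇ ℝ, Tendsto (fun n => ∫ x, f x ∂(μs n)) atTop (𝓝 (∫ x, f x ∂μ))

/-- The total variation metric `2 sup_B |μ(B) - ν(B)|`, for probability measures. -/
def tvDist {S : Type*} [MeasurableSpace S] (μ ν : Measure S) : ℝ :=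
  2 * ⨆ B : {B : Set S // MeasurableSet B}, |μ.real B.1 - ν.real B.1|

/-- `𝒯(·|x,u)` is weakly continuous in `(x,u)`. -/
def IsWeaklyContinuous {X U : Type*} [TopologicalSpace X] [MeasurableSpace X]
    [TopologicalSpace U] [MeasurableSpace U] (T : Kernel (X × U) X) : Prop :=
  ∀ (xs : ℕ → X) (us : ℕ → U) (x : X) (u : U),
    Tendsto xs atTop (𝓝 x) → Tendsto us atTop (𝓝 u) →
      WeaklyConverges (fun k => T (xs k, us k)) (T (x, u))

/-- `Q(·|x)` is continuous in total variation. -/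
def IsTVContinuous {X Y : Type*} [TopologicalSpace X] [MeasurableSpace X]
    [MeasurableSpace Y] (Q : Kernel X Y) : Prop :=
  ∀ (xs : ℕ → X) (x : X), Tendsto xs atTop (𝓝 x) →
    Tendsto (fun k => tvDist (Q (xs k)) (Q x)) atTop (𝓝 0)

/-- `𝒯ₙ(·|xₙ,uₙ) → 𝒯(·|x,u)` weakly whenever `(xₙ,uₙ) → (x,u)`. -/
def ConvergesContinuouslyWeakly {X U : Type*} [TopologicalSpace X] [MeasurableSpace X]
    [TopologicalSpace U] [MeasurableSpace U] (Ts : ℕ → Kernel (X × U) X)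
    (T : Kernel (X × U) X) : Prop :=
  ∀ (xs : ℕ → X) (us : ℕ → U) (x : X) (u : U),
    Tendsto xs atTop (𝓝 x) → Tendsto us atTop (𝓝 u) →
      WeaklyConverges (fun n => Ts n (xs n, us n)) (T (x, u))

/-- An admissible policy: for each `t`, a measurable control function
`γ_t` of the information `I_t = (Y_0,…,Y_t, U_0,…,U_{t-1})`. -/
structure Policy (Y U : Type*) [MeasurableSpace Y] [MeasurableSpace U] where
  /-- the control functions -/
  act : (t : ℕ) → (Fin (t + 1) → Y) × (Fin t → U) → U
  measurable_act : ∀ t, Measurable (act t)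

section Model

variable {X Y U : Type*} [MeasurableSpace X] [MeasurableSpace Y] [MeasurableSpace U]

/-- The variables `((X_t, Y_t), U_t)` of one time stage. -/
abbrev Stage (X Y U : Type*) : Type _ := (X × Y) × U

/-- The history `((X_s, Y_s), U_s)`, `s ≤ t`. -/
abbrev History (X Y U : Type*) (t : ℕ) : Type _ := (i : Finset.Iic t) → Stage X Y U

/-- The variables at stage `i` of a history up to time `t`. -/
def History.stage {t : ℕ} (h : History X Y U t) (i : Fin (t + 1)) : Stage X Y U :=
  h ⟨i, Finset.mem_Iic.2 (Nat.lt_succ_iff.1 i.2)⟩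

/-- The current state and action `(X_t, U_t)` of a history up to time `t`. -/
def History.stateAction {t : ℕ} (h : History X Y U t) : X × U :=
  ((h.stage (Fin.last t)).1.1, (h.stage (Fin.last t)).2)

/-- The information `I_{t+1} = (Y_0,…,Y_t,Y_{t+1}, U_0,…,U_t)` obtained from the history up to
time `t` and the next pair `(X_{t+1}, Y_{t+1})`. -/
def nextInfo (t : ℕ) (p : History X Y U t × (X × Y)) :
    (Fin (t + 1 + 1) → Y) × (Fin (t + 1) → U) :=
  (Fin.snoc (α := fun _ => Y) (fun i => (p.1.stage i).1.2) p.2.2, fun i => (p.1.stage i).2)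

/-- The information `I_0 = Y_0` obtained from `(X_0, Y_0)`. -/
def initInfo (p : X × Y) : (Fin 1 → Y) × (Fin 0 → U) :=
  (fun _ => p.2, Fin.elim0)

theorem measurable_stage {t : ℕ} (i : Fin (t + 1)) :
    Measurable fun h : History X Y U t => h.stage i :=
  measurable_pi_apply _

theorem measurable_stateAction (t : ℕ) :
    Measurable fun h : History X Y U t => h.stateAction :=
  (measurable_stage _).fst.fst.prodMk (measurable_stage _).snd

theorem measurable_nextInfo (t : ℕ) :
    Measurable (nextInfo (X := X) (Y := Y) (U := U) t) := by
  refine Measurable.prodMk (measurable_pi_iff.2 fun i => ?_) (measurable_pi_iff.2 fun i => ?_)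
  · induction i using Fin.lastCases with
    | last => simpa using measurable_snd.snd
    | cast i => simpa using ((measurable_stage i).comp measurable_fst).fst.snd
  · exact ((measurable_stage i).comp measurable_fst).snd

theorem measurable_initInfo : Measurable (initInfo (X := X) (Y := Y) (U := U)) :=
  (measurable_pi_iff.2 fun _ => measurable_snd).prodMk measurable_const

/-- The law of `((X_0, Y_0), U_0)`: `X_0 ∼ P`, `Y_0 ∼ Q(·|X_0)`, `U_0 = γ_0(Y_0)`. -/
def initLaw (P : Measure X) (Q : Kernel X Y) (γ : Policy Y U) : Measure (Stage X Y U) :=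
  (P.compProd Q).compProd
    (Kernel.deterministic (fun p => γ.act 0 (initInfo p))
      ((γ.measurable_act 0).comp measurable_initInfo))

/-- The conditional law of `((X_{t+1}, Y_{t+1}), U_{t+1})` given the history up to time `t`:
`X_{t+1} ∼ 𝒯(·|X_t, U_t)`, `Y_{t+1} ∼ Q(·|X_{t+1})`, `U_{t+1} = γ_{t+1}(I_{t+1})`. -/
def stepKernel (Q : Kernel X Y) (T : Kernel (X × U) X) (γ : Policy Y U) (t : ℕ) :
    Kernel (History X Y U t) (Stage X Y U) :=
  ((T.comap (fun h => h.stateAction) (measurable_stateAction t)).compProd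
      (Q.comap Prod.snd measurable_snd)).compProd
    (Kernel.deterministic (fun p => γ.act (t + 1) (nextInfo t p))
      ((γ.measurable_act (t + 1)).comp (measurable_nextInfo t)))

instance (P : Measure X) [IsProbabilityMeasure P] (Q : Kernel X Y) [IsMarkovKernel Q]
    (γ : Policy Y U) : IsProbabilityMeasure (initLaw P Q γ) := by
  unfold initLaw; infer_instance

instance (Q : Kernel X Y) [IsMarkovKernel Q] (T : Kernel (X × U) X) [IsMarkovKernel T]
    (γ : Policy Y U) (t : ℕ) : IsMarkovKernel (stepKernel Q T γ t) := by
  unfold stepKernel; infer_instance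

/-- The law of the controlled process `((X_t, Y_t), U_t)_{t ≥ 0}` with prior `P`, channel `Q`,
transition kernel `T` and policy `γ` (Ionescu-Tulcea). -/
def processLaw (P : Measure X) (Q : Kernel X Y) [IsMarkovKernel Q]
    (T : Kernel (X × U) X) [IsMarkovKernel T] (γ : Policy Y U) :
    Measure (ℕ → Stage X Y U) :=
  Kernel.trajMeasure (X := fun _ => Stage X Y U) (initLaw P Q γ) (stepKernel Q T γ)

/-- The discounted cost `J_β(P,𝒯,γ) = E[∑_t β^t c(X_t,U_t)]`. -/
def discountedCost (β : ℝ) (c : X → U → ℝ) (P : Measure X) (Q : Kernel X Y) [IsMarkovKernel Q]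
    (T : Kernel (X × U) X) [IsMarkovKernel T] (γ : Policy Y U) : ℝ :=
  ∫ ω, ∑' t : ℕ, β ^ t * c (ω t).1.1 (ω t).2 ∂(processLaw P Q T γ)

/-- The optimal cost `J_β^*(P,𝒯) = inf_γ J_β(P,𝒯,γ)`. -/
def optimalCost (β : ℝ) (c : X → U → ℝ) (P : Measure X) (Q : Kernel X Y) [IsMarkovKernel Q]
    (T : Kernel (X × U) X) [IsMarkovKernel T] : ℝ :=
  ⨅ γ : Policy Y U, discountedCost β c P Q T γ

/-- `γ` is an optimal policy for the model with transition kernel `𝒯`. -/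
def IsOptimalPolicy (β : ℝ) (c : X → U → ℝ) (P : Measure X) (Q : Kernel X Y) [IsMarkovKernel Q]
    (T : Kernel (X × U) X) [IsMarkovKernel T] (γ : Policy Y U) : Prop :=
  discountedCost β c P Q T γ = optimalCost β c P Q T

end Model

end RobustPOMDP

end

noncomputable section

namespace RobustPOMDP

/-! The heart of the matter is that, for an arbitrary sequence of policies, the costs under `Ts i`
and under `T` become asymptotically equal (`tendsto_discountedCost_sub`). Optimality then follows by
comparing each `γs i` with one fixed nearly optimal policy for `T`.

Dominated convergence over stages reduces this to a single expected stage cost, treated by backward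
recursion in `tendsto_integral_processLaw_sub`. Policies are merely measurable, so no regularity in
past observations and actions is available: the record is only a parameter, and all estimates are
uniform in it (the filter `atTop ×ˢ ⊤`). In the current state, test functions are asymptotically
equicontinuous. Averaging over an observation preserves this by total variation continuity of `Q`;
averaging over a transition preserves it by weak continuity of `T` and compactness of the action
space.

Weak convergence is uniform over bounded asymptotically equicontinuous families, so replacing `Ts i`
by `T` in one transition leaves an error that vanishes continuously. That property survives further
steps of the `Ts i` model, so the error can be carried back to time zero and integrated against `P`
by dominated convergence. -/

/-- The family `f` is asymptotically equicontinuous along `l`. -/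
def AsymptEquicontinuous {ι S : Type*} [TopologicalSpace S] (l : Filter ι) (f : ι → S → ℝ) :
    Prop :=
  ∀ x, Tendsto (fun p : ι × S => f p.1 p.2 - f p.1 x) (l ×ˢ 𝓝 x) (𝓝 0)

/-- The family `f` converges continuously to zero along `l`. -/
def VanishesContinuously {ι S : Type*} [TopologicalSpace S] (l : Filter ι) (f : ι → S → ℝ) :
    Prop :=
  ∀ x, Tendsto (fun p : ι × S => f p.1 p.2) (l ×ˢ 𝓝 x) (𝓝 0)

theorem VanishesContinuously.tendsto {ι S : Type*} [TopologicalSpace S] {l : Filter ι}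
    {f : ι → S → ℝ}
    (hf : VanishesContinuously l f) (x : S) : Tendsto (fun a => f a x) l (𝓝 0) :=
  (hf x).comp (tendsto_id.prodMk (tendsto_const_nhds (x := x)))

theorem VanishesContinuously.asymptEquicontinuous {ι S : Type*} [TopologicalSpace S]
    {l : Filter ι} {f : ι → S → ℝ}
    (hf : VanishesContinuously l f) : AsymptEquicontinuous l f := fun x => by
  simpa using (hf x).sub ((hf.tendsto x).comp tendsto_fst)

/-! ### Weak convergence against varying test functions -/

section WeakConvergence

variable {S : Type*} [PseudoMetricSpace S] [SecondCountableTopology S] [MeasurableSpace S]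
  [BorelSpace S]

/-- Finite partial partitions of unity subordinate to a system of neighbourhoods, with small
defect in measure. -/
theorem exists_partition_integral_lt (ν : Measure S) [IsProbabilityMeasure ν]
    {V : S → Set S} (hV : ∀ x, V x ∈ 𝓝 x) {ε : ℝ} (hε : 0 < ε) :
    ∃ (K : ℕ) (e : ℕ → S) (φ : ℕ → S →ᵇ ℝ), (∀ k z, 0 ≤ φ k z) ∧
      (∀ k z, φ k z ≠ 0 → z ∈ V (e k)) ∧ (∀ z, ∑ k ∈ Finset.range K, φ k z ≤ 1) ∧
      ∫ z, (1 - ∑ k ∈ Finset.range K, φ k z) ∂ν < ε := by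
  choose r hr0 hrV using fun x => Metric.mem_nhds_iff.1 (hV x)
  obtain ⟨s, hs, hcov⟩ := TopologicalSpace.countable_cover_nhds
    (fun x => Metric.ball_mem_nhds x (hr0 x))
  obtain ⟨z₀⟩ : Nonempty S := nonempty_of_isProbabilityMeasure ν
  have hsne : s.Nonempty := by
    have : z₀ ∈ ⋃ x ∈ s, Metric.ball x (r x) := hcov ▸ Set.mem_univ z₀
    simp only [Set.mem_iUnion] at this
    obtain ⟨x, hx, -⟩ := this
    exact ⟨x, hx⟩
  obtain ⟨e, rfl⟩ := hs.exists_eq_range hsne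
  let ψ : ℕ → S → ℝ := fun k z => max 0 (r (e k) - dist z (e k))
  have hψ0 : ∀ k z, 0 ≤ ψ k z := fun k z => le_max_left _ _
  have hψc : ∀ k, Continuous (ψ k) := fun k => by fun_prop
  -- The summand `1 / (K + 1)` keeps the denominator positive where all tents vanish; it is also the
  -- numerator of the defect, which tends to zero at every point because some tent is positive
  -- there.
  let D : ℕ → S → ℝ := fun K z => 1 / ((K : ℝ) + 1) + ∑ k ∈ Finset.range K, ψ k z
  have hone : ∀ K : ℕ, 0 < 1 / ((K : ℝ) + 1) := fun K => by positivity
  have hsum0 : ∀ K z, 0 ≤ ∑ k ∈ Finset.range K, ψ k z :=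
    fun K z => Finset.sum_nonneg fun k _ => hψ0 k z
  have hD : ∀ K z, 0 < D K z := fun K z => add_pos_of_pos_of_nonneg (hone K) (hsum0 K z)
  have hDc : ∀ K, Continuous (D K) := fun K => by fun_prop
  have hdef : ∀ K z, 1 - ∑ k ∈ Finset.range K, ψ k z / D K z = 1 / ((K : ℝ) + 1) / D K z := by
    intro K z
    rw [← Finset.sum_div, eq_div_iff (hD K z).ne', sub_mul, div_mul_cancel₀ _ (hD K z).ne']
    simp [D]
  have hlim : Tendsto (fun K : ℕ => ∫ z, (1 / ((K : ℝ) + 1) / D K z) ∂ν) atTop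
      (𝓝 (∫ _, (0 : ℝ) ∂ν)) := by
    refine tendsto_integral_of_dominated_convergence (fun _ => 1)
      (fun K => (continuous_const.div (hDc K) fun z => (hD K z).ne').aestronglyMeasurable)
      (integrable_const _) (fun K => .of_forall fun z => ?_) (.of_forall fun z => ?_)
    · rw [Real.norm_of_nonneg (div_nonneg (hone K).le (hD K z).le)]
      exact div_le_one_of_le₀ (le_add_of_nonneg_right (hsum0 K z)) (hD K z).le
    · have : z ∈ ⋃ x ∈ Set.range e, Metric.ball x (r x) := hcov ▸ Set.mem_univ z
      simp only [Set.mem_iUnion, Set.mem_range] at this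
      obtain ⟨_, ⟨k, rfl⟩, hk⟩ := this
      have hpos : 0 < ψ k z := lt_max_of_lt_right (sub_pos.2 hk)
      have h0 : Tendsto (fun K : ℕ => 1 / ((K : ℝ) + 1) / ψ k z) atTop (𝓝 0) := by
        simpa using (tendsto_one_div_add_atTop_nhds_zero_nat (𝕜 := ℝ)).div_const (ψ k z)
      refine squeeze_zero' (.of_forall fun K => div_nonneg (hone K).le (hD K z).le) ?_ h0
      filter_upwards [eventually_gt_atTop k] with K hK
      refine div_le_div_of_nonneg_left (hone K).le hpos ?_
      exact (Finset.single_le_sum (f := fun k => ψ k z) (fun k _ => hψ0 k z)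
        (Finset.mem_range.2 hK)).trans (le_add_of_nonneg_left (hone K).le)
  obtain ⟨K, hK⟩ := (hlim.eventually (gt_mem_nhds (by simpa using hε))).exists
  -- The quotients are known to be at most 1 only for `k < K`. The cap makes every member of the
  -- sequence bounded and changes nothing for those indices.
  have hbd : ∀ k z, ‖min 1 (ψ k z / D K z)‖ ≤ 1 := fun k z => by
    rw [Real.norm_of_nonneg (le_min zero_le_one (div_nonneg (hψ0 k z) (hD K z).le))]
    exact min_le_left _ _
  have hmin : ∀ z, ∀ k ∈ Finset.range K, min 1 (ψ k z / D K z) = ψ k z / D K z := by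
    intro z k hk
    refine min_eq_right (div_le_one_of_le₀ ?_ (hD K z).le)
    exact (Finset.single_le_sum (f := fun k => ψ k z) (fun k _ => hψ0 k z) hk).trans
      (le_add_of_nonneg_left (hone K).le)
  refine ⟨K, e, fun k => BoundedContinuousFunction.ofNormedAddCommGroup
    (fun z => min 1 (ψ k z / D K z))
    (continuous_const.min ((hψc k).div (hDc K) fun z => (hD K z).ne')) 1 (hbd k), ?_, ?_, ?_, ?_⟩
  · exact fun k z => le_min zero_le_one (div_nonneg (hψ0 k z) (hD K z).le)
  · intro k z hz
    refine hrV _ ?_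
    by_contra hcon
    apply hz
    have : ψ k z = 0 := max_eq_left (sub_nonpos.2 (not_lt.1 hcon))
    simp [this]
  · intro z
    have := hdef K z
    simp only [BoundedContinuousFunction.coe_ofNormedAddCommGroup]
    rw [Finset.sum_congr rfl (hmin z)]
    have h2 : 0 ≤ 1 / ((K : ℝ) + 1) / D K z := div_nonneg (hone K).le (hD K z).le
    linarith
  · simp only [BoundedContinuousFunction.coe_ofNormedAddCommGroup]
    refine lt_of_eq_of_lt (integral_congr_ae (.of_forall fun z => ?_)) hK
    simp only
    rw [Finset.sum_congr rfl (hmin z), hdef]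

theorem integrable_of_abs_le {Ω : Type*} [MeasurableSpace Ω] {μ : Measure Ω} [IsFiniteMeasure μ]
    {f : Ω → ℝ} (hf : Measurable f) {C : ℝ} (hC : ∀ x, |f x| ≤ C) : Integrable f μ :=
  .of_bound hf.aestronglyMeasurable C (.of_forall hC)

theorem abs_integral_le_of_abs_le {Ω : Type*} [MeasurableSpace Ω] {μ : Measure Ω}
    [IsProbabilityMeasure μ] {f : Ω → ℝ} {C : ℝ} (hC : ∀ x, |f x| ≤ C) :
    |∫ x, f x ∂μ| ≤ C := by
  simpa using norm_integral_le_of_norm_le_const (μ := μ) (f := f) (.of_forall hC)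

/-- Weak convergence of probability measures is uniform over bounded asymptotically
equicontinuous families. -/
theorem tendsto_integral_sub_integral_of_asymptEquicontinuous {ι : Type*} {l : Filter ι}
    {μ : ι → Measure S} [∀ a, IsProbabilityMeasure (μ a)] {ν : Measure S}
    [IsProbabilityMeasure ν]
    (hμ : ∀ f : S →ᵇ ℝ, Tendsto (fun a => ∫ x, f x ∂μ a) l (𝓝 (∫ x, f x ∂ν)))
    {g : ι → S → ℝ} (hgm : ∀ a, Measurable (g a)) {C : ℝ} (hgC : ∀ a x, |g a x| ≤ C)
    (hg : AsymptEquicontinuous l g) :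
    Tendsto (fun a => ∫ x, g a x ∂μ a - ∫ x, g a x ∂ν) l (𝓝 0) := by
  rcases isEmpty_or_nonempty ι with hι | ⟨⟨a₀⟩⟩
  · rw [Filter.filter_eq_bot_of_isEmpty l]; exact tendsto_bot
  obtain ⟨z₀⟩ : Nonempty S := nonempty_of_isProbabilityMeasure ν
  have hC : 0 ≤ C := (abs_nonneg _).trans (hgC a₀ z₀)
  -- Each replacement of `g a` by its finite approximation costs `ε` plus `C` times the mass of the
  -- defect, which is below `2 * ε` for `μ a` and below `ε` for `ν`. Comparing the finite sums costs
  -- a further `ε`.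
  have main : ∀ ε > 0, ∀ᶠ a in l, |∫ x, g a x ∂μ a - ∫ x, g a x ∂ν| ≤ (3 + 3 * C) * ε := by
    intro ε hε
    have h1 : ∀ x, ∃ A ∈ l, ∃ V ∈ 𝓝 x, ∀ a ∈ A, ∀ z ∈ V, |g a z - g a x| ≤ ε := by
      intro x
      have := (hg x).eventually (Metric.closedBall_mem_nhds 0 hε)
      obtain ⟨A, hA, V, hV, h⟩ := Filter.mem_prod_iff.1 this
      refine ⟨A, hA, V, hV, fun a ha z hz => ?_⟩
      simpa using h (Set.mk_mem_prod ha hz)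
    choose A hA V hV hAV using h1
    obtain ⟨K, e, φ, hφ0, hφV, hφ1, hφν⟩ := exists_partition_integral_lt ν hV hε
    let G : ι → S → ℝ := fun a z => ∑ k ∈ Finset.range K, g a (e k) * φ k z
    let ρ : S →ᵇ ℝ := 1 - ∑ k ∈ Finset.range K, φ k
    have hρ : ∀ z, ρ z = 1 - ∑ k ∈ Finset.range K, φ k z := fun z => by simp [ρ]
    have hρν : ∫ z, ρ z ∂ν < ε := by simpa only [hρ] using hφν
    have hkey : ∀ a, (∀ k ∈ Finset.range K, a ∈ A (e k)) → ∀ z,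
        |g a z - G a z| ≤ ε + C * ρ z := by
      intro a ha z
      have : g a z - G a z = ∑ k ∈ Finset.range K, (g a z - g a (e k)) * φ k z + g a z * ρ z := by
        simp only [G, hρ, sub_mul, Finset.sum_sub_distrib, ← Finset.mul_sum]; ring
      rw [this]
      have hρ0 : 0 ≤ ρ z := by rw [hρ]; linarith [hφ1 z]
      refine (abs_add_le _ _).trans (add_le_add ?_ ?_)
      · refine (Finset.abs_sum_le_sum_abs _ _).trans ?_
        calc _ ≤ ∑ k ∈ Finset.range K, ε * φ k z := by
              refine Finset.sum_le_sum fun k hk => ?_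
              rw [abs_mul, abs_of_nonneg (hφ0 k z)]
              by_cases h0 : φ k z = 0
              · simp [h0]
              · exact mul_le_mul_of_nonneg_right (hAV _ a (ha k hk) z (hφV k z h0)) (hφ0 k z)
          _ ≤ ε := by
              rw [← Finset.mul_sum]; exact mul_le_of_le_one_right hε.le (hφ1 z)
      · rw [abs_mul, abs_of_nonneg hρ0]
        exact mul_le_mul_of_nonneg_right (hgC a z) hρ0
    have hint : ∀ (f : S →ᵇ ℝ) (m : Measure S) [IsProbabilityMeasure m], Integrable f m :=
      fun f m _ => f.integrable m
    have happ : ∀ a, (∀ k ∈ Finset.range K, a ∈ A (e k)) → ∀ (m : Measure S)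
        [IsProbabilityMeasure m],
        |∫ z, g a z ∂m - ∑ k ∈ Finset.range K, g a (e k) * ∫ z, φ k z ∂m|
          ≤ ε + C * ∫ z, ρ z ∂m := by
      intro a ha m _
      have hGi : ∫ z, G a z ∂m = ∑ k ∈ Finset.range K, g a (e k) * ∫ z, φ k z ∂m := by
        rw [integral_finsetSum _ fun k _ => (hint _ _).const_mul _]
        simp only [integral_const_mul]
      have hgi : Integrable (g a) m := integrable_of_abs_le (hgm a) (hgC a)
      have hGint : Integrable (G a) m := integrable_finsetSum _ fun k _ => (hint _ _).const_mul _
      rw [← hGi, ← integral_sub hgi hGint]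
      calc _ ≤ ∫ z, |g a z - G a z| ∂m := abs_integral_le_integral_abs
        _ ≤ ∫ z, (ε + C * ρ z) ∂m :=
            integral_mono (hgi.sub hGint).abs
              ((integrable_const _).add ((hint _ _).const_mul _)) (hkey a ha)
        _ = _ := by
            rw [integral_add (integrable_const _) ((hint _ _).const_mul _), integral_const_mul]
            simp
    have hsumlim : Tendsto (fun a => ∑ k ∈ Finset.range K,
        C * |∫ z, φ k z ∂μ a - ∫ z, φ k z ∂ν|) l (𝓝 0) := by
      have : ∀ k ∈ Finset.range K, Tendsto (fun a => C * |∫ z, φ k z ∂μ a - ∫ z, φ k z ∂ν|) l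
          (𝓝 0) := fun k _ => by
        simpa using (((hμ (φ k)).sub_const (∫ z, φ k z ∂ν)).abs).const_mul C
      simpa using tendsto_finsetSum _ this
    have hA' : ∀ᶠ a in l, ∀ k ∈ Finset.range K, a ∈ A (e k) :=
      (Filter.eventually_all_finset _).2 fun k _ => hA (e k)
    filter_upwards [hA', hsumlim.eventually (ge_mem_nhds hε),
      (hμ ρ).eventually (gt_mem_nhds (hρν.trans (lt_two_mul_self hε)))] with a ha1 ha2 ha3
    have e1 := abs_le.1 (happ a ha1 (μ a))
    have e2 := abs_le.1 (happ a ha1 ν)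
    have e3 : |∑ k ∈ Finset.range K, g a (e k) * ∫ z, φ k z ∂μ a -
        ∑ k ∈ Finset.range K, g a (e k) * ∫ z, φ k z ∂ν| ≤ ε := by
      rw [← Finset.sum_sub_distrib]
      refine (Finset.abs_sum_le_sum_abs _ _).trans (le_trans (Finset.sum_le_sum fun k _ => ?_) ha2)
      rw [← mul_sub, abs_mul]
      exact mul_le_mul_of_nonneg_right (hgC a _) (abs_nonneg _)
    have e4 := abs_le.1 e3
    have e5 : C * ∫ z, ρ z ∂μ a ≤ C * (2 * ε) := mul_le_mul_of_nonneg_left ha3.le hC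
    have e6 : C * ∫ z, ρ z ∂ν ≤ C * ε := mul_le_mul_of_nonneg_left hρν.le hC
    rw [abs_le]
    constructor <;> linarith [e1.1, e1.2, e2.1, e2.2, e4.1, e4.2]
  rw [Metric.tendsto_nhds]
  intro ε hε
  have hpos : 0 < 3 + 3 * C := by positivity
  filter_upwards [main (ε / 2 / (3 + 3 * C)) (by positivity)] with a ha
  rw [mul_div_cancel₀ _ hpos.ne'] at ha
  rw [Real.dist_eq, sub_zero]
  linarith

/-- Uniformity over the family allows `μ a` to be replaced by the fixed measure `ν`, where dominated
convergence applies; the latter is why the filter must be countably generated. -/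
theorem VanishesContinuously.tendsto_integral {ι : Type*} {l : Filter ι}
    [l.IsCountablyGenerated]
    {μ : ι → Measure S} [∀ a, IsProbabilityMeasure (μ a)] {ν : Measure S}
    [IsProbabilityMeasure ν]
    (hμ : ∀ f : S →ᵇ ℝ, Tendsto (fun a => ∫ x, f x ∂μ a) l (𝓝 (∫ x, f x ∂ν)))
    {g : ι → S → ℝ} (hgm : ∀ a, Measurable (g a)) {C : ℝ} (hgC : ∀ a x, |g a x| ≤ C)
    (hg : VanishesContinuously l g) :
    Tendsto (fun a => ∫ x, g a x ∂μ a) l (𝓝 0) := by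
  have h1 := tendsto_integral_sub_integral_of_asymptEquicontinuous hμ hgm hgC
    hg.asymptEquicontinuous
  have h2 : Tendsto (fun a => ∫ x, g a x ∂ν) l (𝓝 (∫ _, (0 : ℝ) ∂ν)) :=
    tendsto_integral_filter_of_dominated_convergence (fun _ => C)
      (.of_forall fun a => (hgm a).aestronglyMeasurable)
      (.of_forall fun a => .of_forall (hgC a)) (integrable_const C)
      (.of_forall fun x => hg.tendsto x)
  simpa using h1.add h2

end WeakConvergence

/-! ### Total variation and integrals of bounded functions -/

section TotalVariation

variable {S : Type*} [MeasurableSpace S]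

theorem two_mul_abs_measureReal_sub_le_tvDist (μ ν : Measure S) [IsProbabilityMeasure μ]
    [IsProbabilityMeasure ν] {B : Set S} (hB : MeasurableSet B) :
    2 * |μ.real B - ν.real B| ≤ tvDist μ ν := by
  refine mul_le_mul_of_nonneg_left ?_ zero_le_two
  refine le_ciSup (f := fun B : {B : Set S // MeasurableSet B} => |μ.real B.1 - ν.real B.1|)
    ⟨1, ?_⟩ ⟨B, hB⟩
  rintro _ ⟨B, rfl⟩
  have h1 : μ.real B.1 ≤ 1 := measureReal_le_one
  have h2 : ν.real B.1 ≤ 1 := measureReal_le_one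
  exact abs_sub_le_iff.2 ⟨by linarith [measureReal_nonneg (μ := ν) (s := B.1)],
    by linarith [measureReal_nonneg (μ := μ) (s := B.1)]⟩

/-- By the layer-cake formula for `f + C`, which takes values in `[0, 2 * C]`, the difference is an
integral over that interval of differences of measures of superlevel sets, each at most `tvDist μ ν
/ 2`. -/
theorem abs_integral_sub_integral_le_tvDist (μ ν : Measure S) [IsProbabilityMeasure μ]
    [IsProbabilityMeasure ν] {f : S → ℝ} (hf : Measurable f) {C : ℝ} (hC : ∀ x, |f x| ≤ C) :
    |∫ x, f x ∂μ - ∫ x, f x ∂ν| ≤ C * tvDist μ ν := by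
  obtain ⟨z₀⟩ : Nonempty S := nonempty_of_isProbabilityMeasure ν
  have hC0 : 0 ≤ C := (abs_nonneg _).trans (hC z₀)
  have hlayer : ∀ (m : Measure S) [IsProbabilityMeasure m],
      ∫ x, f x ∂m + C = ∫ t in (0 : ℝ)..(2 * C), m.real {x | t < f x + C} := by
    intro m _
    have hi : Integrable f m := integrable_of_abs_le hf hC
    have h1 : ∫ x, (f x + C) ∂m = ∫ x, f x ∂m + C := by
      rw [integral_add hi (integrable_const _)]; simp
    have h2 := (hi.add (integrable_const C)).integral_eq_integral_meas_lt
      (.of_forall fun x => by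
        have := (abs_le.1 (hC x)).1
        simp only [Pi.zero_apply, Pi.add_apply]; linarith)
    simp only [Pi.add_apply] at h2
    rw [← h1, h2, intervalIntegral.integral_of_le (by linarith)]
    refine setIntegral_eq_of_subset_of_forall_sdiff_eq_zero measurableSet_Ioi
      Set.Ioc_subset_Ioi_self fun t ht => ?_
    have : {x | t < f x + C} = ∅ := by
      refine Set.eq_empty_of_forall_notMem fun x hx => ht.2 ⟨ht.1, ?_⟩
      have := (abs_le.1 (hC x)).2
      have hx' : t < f x + C := hx
      linarith
    simp [this]
  have hanti : ∀ (m : Measure S) [IsProbabilityMeasure m],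
      IntervalIntegrable (fun t => m.real {x | t < f x + C}) volume 0 (2 * C) := by
    intro m _
    refine Antitone.intervalIntegrable fun s t hst => ?_
    exact measureReal_mono fun x hx => lt_of_le_of_lt hst hx
  have heq : ∫ x, f x ∂μ - ∫ x, f x ∂ν = ∫ t in (0 : ℝ)..(2 * C),
      (μ.real {x | t < f x + C} - ν.real {x | t < f x + C}) := by
    rw [intervalIntegral.integral_sub (hanti μ) (hanti ν), ← hlayer μ, ← hlayer ν]; ring
  rw [heq]
  have := intervalIntegral.norm_integral_le_of_norm_le_const (a := (0 : ℝ)) (b := 2 * C)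
    (f := fun t => μ.real {x | t < f x + C} - ν.real {x | t < f x + C}) (C := tvDist μ ν / 2)
    (fun t _ => by
      have := two_mul_abs_measureReal_sub_le_tvDist μ ν
        (B := {x | t < f x + C}) (measurableSet_lt measurable_const (hf.add_const C))
      rw [Real.norm_eq_abs]; linarith)
  rw [sub_zero, abs_of_nonneg (by linarith), Real.norm_eq_abs] at this
  linarith

end TotalVariation

/-! ### Compactness and sequential criteria for filters -/

/-- Every ultrafilter pushes forward along `u` to a convergent one, so in a limit argument the
actions may be assumed to converge, although `u` has no regularity. -/
theorem tendsto_of_forall_inf_comap_nhds {ι V β : Type*} [TopologicalSpace V] [CompactSpace V]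
    {l : Filter ι} {m : Filter β} (u : ι → V) {F : ι → β}
    (h : ∀ v, Tendsto F (l ⊓ comap u (𝓝 v)) m) : Tendsto F l m := by
  rw [tendsto_iff_ultrafilter]
  intro g hg
  exact (h _).mono_left (le_inf hg (map_le_iff_le_comap.1 (g.map u).le_nhds_lim))

theorem tendsto_prod_nhds_of_forall_seq {α β : Type*} [TopologicalSpace α]
    {a : α} [(𝓝 a).IsCountablyGenerated] {F : ℕ → α → β} {m : Filter β}
    (h : ∀ s : ℕ → α, Tendsto s atTop (𝓝 a) → Tendsto (fun n => F n (s n)) atTop m) :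
    Tendsto (fun p : ℕ × α => F p.1 p.2) (atTop ×ˢ 𝓝 a) m := by
  by_contra hcon
  simp only [Tendsto, Filter.le_def, not_forall] at hcon
  obtain ⟨W, hW, hWn⟩ := hcon
  obtain ⟨ns, hns, hbad⟩ := exists_seq_forall_of_frequently
    (show ∃ᶠ p : ℕ × α in atTop ×ˢ 𝓝 a, F p.1 p.2 ∉ W from fun hev =>
      hWn (hev.mono fun p hp => not_not.1 hp))
  obtain ⟨φ, hφ, hθ⟩ := strictMono_subseq_of_tendsto_atTop (tendsto_fst.comp hns)
  set θ : ℕ → ℕ := (Prod.fst ∘ ns) ∘ φ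
  -- A full sequence is needed, so the bad points are placed at their own indices `θ k` and the gaps
  -- are filled with the limit `a`.
  have hs : Tendsto (Function.extend θ (fun k => (ns (φ k)).2) fun _ => a) atTop (𝓝 a) := by
    intro V hV
    have h1 : ∀ᶠ k in atTop, (ns (φ k)).2 ∈ V :=
      ((tendsto_snd.comp hns).comp hφ.tendsto_atTop).eventually hV
    obtain ⟨K, hK⟩ := eventually_atTop.1 h1
    refine mem_map.2 (mem_atTop_sets.2 ⟨θ K, fun n hn => ?_⟩)
    by_cases hex : ∃ k, θ k = n
    · obtain ⟨k, rfl⟩ := hex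
      rw [Set.mem_preimage, hθ.injective.extend_apply]
      exact hK k (hθ.le_iff_le.1 hn)
    · rw [Set.mem_preimage, Function.extend_apply' _ _ _ hex]
      exact mem_of_mem_nhds hV
  obtain ⟨k, hk⟩ := (((h _ hs).comp hθ.tendsto_atTop).eventually hW).exists
  simp only [Function.comp_apply, hθ.injective.extend_apply] at hk
  exact hbad (φ k) hk

/-! ### Averaging over an observation -/

section Observation

variable {X Y ι ι' : Type*} [TopologicalSpace X]

theorem tendsto_prod_top_iff {ι α : Type*} {l : Filter ι} {F : ι × α → ℝ} :
    Tendsto F (l ×ˢ ⊤) (𝓝 0) ↔ ∀ ε > 0, ∀ᶠ a in l, ∀ b, |F (a, b)| ≤ ε := by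
  constructor
  · intro h ε hε
    have := h.eventually (Metric.closedBall_mem_nhds 0 hε)
    rw [← principal_univ, eventually_prod_principal_iff] at this
    filter_upwards [this] with a ha b
    simpa using ha b (Set.mem_univ b)
  · intro h
    rw [Metric.tendsto_nhds]
    intro ε hε
    rw [← principal_univ, eventually_prod_principal_iff]
    filter_upwards [h (ε / 2) (half_pos hε)] with a ha b _
    rw [Real.dist_eq, sub_zero]
    linarith [ha b]

/-- The integral of a uniformly vanishing family vanishes. -/
theorem tendsto_integral_of_tendsto_prod_top {Ω : Type*} [MeasurableSpace Ω] {l : Filter ι}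
    {μ : ι → Measure Ω} [∀ a, IsProbabilityMeasure (μ a)] {F : ι × Ω → ℝ}
    (hF : Tendsto F (l ×ˢ ⊤) (𝓝 0)) : Tendsto (fun a => ∫ y, F (a, y) ∂μ a) l (𝓝 0) := by
  rw [Metric.tendsto_nhds]
  intro ε hε
  filter_upwards [tendsto_prod_top_iff.1 hF (ε / 2) (half_pos hε)] with a ha
  rw [Real.dist_eq, sub_zero]
  linarith [abs_integral_le_of_abs_le (μ := μ a) ha]

theorem tendsto_reindex {l : Filter ι} {l' : Filter ι'} {σ : ι → Y → ι'}
    (hσ : Tendsto (fun p : ι × Y => σ p.1 p.2) (l ×ˢ ⊤) l') (x : X) :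
    Tendsto (fun q : (ι × X) × Y => (σ q.1.1 q.2, q.1.2)) ((l ×ˢ 𝓝 x) ×ˢ ⊤) (l' ×ˢ 𝓝 x) :=
  (hσ.comp ((tendsto_fst.comp tendsto_fst).prodMk tendsto_snd)).prodMk
    (tendsto_snd.comp tendsto_fst)

variable [MeasurableSpace X] [MeasurableSpace Y]

/-- Since `σ` tends to `l'` uniformly in `y`, the integrand is uniformly small in `y`, so the
measures `Q x` need no continuity. -/
theorem VanishesContinuously.integral_channel {l : Filter ι} {l' : Filter ι'}
    {Q : Kernel X Y} [IsMarkovKernel Q] {σ : ι → Y → ι'}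
    (hσ : Tendsto (fun p : ι × Y => σ p.1 p.2) (l ×ˢ ⊤) l') {f : ι' → X → ℝ}
    (hf : VanishesContinuously l' f) :
    VanishesContinuously l fun a x => ∫ y, f (σ a y) x ∂Q x := fun x =>
  tendsto_integral_of_tendsto_prod_top (μ := fun p : ι × X => Q p.2)
    (F := fun q => f (σ q.1.1 q.2) q.1.2) ((hf x).comp (tendsto_reindex hσ x))

theorem IsTVContinuous.tendsto {Q : Kernel X Y} (hQ : IsTVContinuous Q) (x : X)
    [(𝓝 x).IsCountablyGenerated] : Tendsto (fun z => tvDist (Q z) (Q x)) (𝓝 x) (𝓝 0) :=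
  tendsto_of_seq_tendsto fun s hs => hQ s x hs

/-- Moving the state inside `f` costs little uniformly in `y`; moving it inside `Q` costs at most
`C` times a total variation distance. Weak continuity of `Q` would not serve here, because `y ↦ f (σ
a y) x` is only measurable. -/
theorem AsymptEquicontinuous.integral_channel [FirstCountableTopology X] {l : Filter ι}
    {l' : Filter ι'}
    {Q : Kernel X Y} [IsMarkovKernel Q] (hQ : IsTVContinuous Q) {σ : ι → Y → ι'}
    (hσ : Tendsto (fun p : ι × Y => σ p.1 p.2) (l ×ˢ ⊤) l') {f : ι' → X → ℝ}
    (hfm : ∀ a x, Measurable fun y => f (σ a y) x) {C : ℝ} (hfC : ∀ b x, |f b x| ≤ C)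
    (hf : AsymptEquicontinuous l' f) :
    AsymptEquicontinuous l fun a x => ∫ y, f (σ a y) x ∂Q x := by
  intro x
  have h1 := tendsto_integral_of_tendsto_prod_top (μ := fun p : ι × X => Q p.2)
    (F := fun q => f (σ q.1.1 q.2) q.1.2 - f (σ q.1.1 q.2) x)
    ((hf x).comp (tendsto_reindex hσ x))
  have h2 : Tendsto (fun p : ι × X => ∫ y, f (σ p.1 y) x ∂Q p.2 - ∫ y, f (σ p.1 y) x ∂Q x)
      (l ×ˢ 𝓝 x) (𝓝 0) := by
    refine squeeze_zero_norm (fun p => abs_integral_sub_integral_le_tvDist (Q p.2) (Q x)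
      (hfm p.1 x) fun y => hfC _ _) ?_
    simpa using ((hQ.tendsto x).comp tendsto_snd).const_mul C
  have h3 := h1.add h2
  rw [add_zero] at h3
  refine h3.congr fun p => ?_
  simp only
  rw [integral_sub (integrable_of_abs_le (hfm _ _) fun y => hfC _ _)
    (integrable_of_abs_le (hfm _ _) fun y => hfC _ _)]
  ring

end Observation

/-! ### Averaging over a transition -/

section Transition

variable {X U ι : Type*} [PseudoMetricSpace X] [MeasurableSpace X] [TopologicalSpace U]
  [MeasurableSpace U]

/-- Continuous weak convergence of a family of kernels along a filter. -/
def TendstoWeaklyJointly (l : Filter ι) (S : ι → Kernel (X × U) X) (T : Kernel (X × U) X) : Prop :=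
  ∀ (x : X) (u : U) (f : X →ᵇ ℝ), Tendsto (fun p : ι × (X × U) => ∫ z, f z ∂S p.1 p.2)
    (l ×ˢ 𝓝 (x, u)) (𝓝 (∫ z, f z ∂T (x, u)))

theorem ConvergesContinuouslyWeakly.tendstoWeaklyJointly [FirstCountableTopology U]
    {Ts : ℕ → Kernel (X × U) X} {T : Kernel (X × U) X}
    (h : ConvergesContinuouslyWeakly Ts T) : TendstoWeaklyJointly atTop Ts T := fun x u f =>
  tendsto_prod_nhds_of_forall_seq (a := (x, u)) (F := fun n q => ∫ z, f z ∂Ts n q) fun s hs =>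
    h (fun n => (s n).1) (fun n => (s n).2) x u ((continuous_fst.tendsto (x, u)).comp hs)
      ((continuous_snd.tendsto (x, u)).comp hs) f

theorem IsWeaklyContinuous.tendstoWeaklyJointly [FirstCountableTopology U]
    {T : Kernel (X × U) X} (h : IsWeaklyContinuous T) (l : Filter ι) :
    TendstoWeaklyJointly l (fun _ => T) T := fun x u f =>
  (tendsto_of_seq_tendsto (f := fun q : X × U => ∫ z, f z ∂T q) fun s hs =>
    h (fun n => (s n).1) (fun n => (s n).2) x u ((continuous_fst.tendsto (x, u)).comp hs)
      ((continuous_snd.tendsto (x, u)).comp hs) f).comp tendsto_snd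

theorem TendstoWeaklyJointly.comp {ι' : Type*} {l : Filter ι} {l' : Filter ι'}
    {S : ι' → Kernel (X × U) X} {T : Kernel (X × U) X} (h : TendstoWeaklyJointly l' S T)
    {r : ι → ι'} (hr : Tendsto r l l') : TendstoWeaklyJointly l (fun a => S (r a)) T :=
  fun x u f => (h x u f).comp (hr.prodMap tendsto_id)

variable {l : Filter ι} {S : ι → Kernel (X × U) X} {T : Kernel (X × U) X}

theorem TendstoWeaklyJointly.tendsto_inf_comap (hS : TendstoWeaklyJointly l S T) (u : ι → U)
    (x : X) (v : U) (f : X →ᵇ ℝ) :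
    Tendsto (fun p : ι × X => ∫ z, f z ∂S p.1 (p.2, u p.1))
      ((l ×ˢ 𝓝 x) ⊓ comap (fun p => u p.1) (𝓝 v)) (𝓝 (∫ z, f z ∂T (x, v))) := by
  refine (hS x v f).comp ((tendsto_fst.mono_left inf_le_left).prodMk ?_)
  rw [nhds_prod_eq]
  exact (tendsto_snd.mono_left inf_le_left).prodMk (tendsto_comap.mono_left inf_le_right)

variable [SecondCountableTopology X] [BorelSpace X] [∀ a, IsMarkovKernel (S a)]
  [IsMarkovKernel T]

theorem AsymptEquicontinuous.tendsto_integral_sub_inf_comap (hS : TendstoWeaklyJointly l S T)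
    (u : ι → U) (x : X) (v : U) {g : ι → X → ℝ} (hgm : ∀ a, Measurable (g a)) {C : ℝ}
    (hgC : ∀ a x, |g a x| ≤ C) (hg : AsymptEquicontinuous l g) :
    Tendsto (fun p : ι × X => ∫ z, g p.1 z ∂S p.1 (p.2, u p.1) - ∫ z, g p.1 z ∂T (x, v))
      ((l ×ˢ 𝓝 x) ⊓ comap (fun p => u p.1) (𝓝 v)) (𝓝 0) := by
  refine tendsto_integral_sub_integral_of_asymptEquicontinuous
    (μ := fun p : ι × X => S p.1 (p.2, u p.1)) (g := fun p => g p.1)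
    (hS.tendsto_inf_comap u x v) (fun p => hgm p.1) (fun p => hgC p.1) fun x' => ?_
  exact (hg x').comp (((tendsto_fst.mono_left inf_le_left).comp tendsto_fst).prodMk tendsto_snd)

/-- The transition operators map asymptotically equicontinuous families to such families, and
their difference vanishes continuously. -/
theorem AsymptEquicontinuous.transition_sub [CompactSpace U] (hS : TendstoWeaklyJointly l S T)
    (hT : TendstoWeaklyJointly l (fun _ => T) T)
    (u : ι → U) {g : ι → X → ℝ} (hgm : ∀ a, Measurable (g a)) {C : ℝ}
    (hgC : ∀ a x, |g a x| ≤ C) (hg : AsymptEquicontinuous l g) :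
    VanishesContinuously l fun a x => ∫ z, g a z ∂S a (x, u a) - ∫ z, g a z ∂T (x, u a) := by
  intro x
  refine tendsto_of_forall_inf_comap_nhds (fun p => u p.1) fun v => ?_
  simpa using (hg.tendsto_integral_sub_inf_comap hS u x v hgm hgC).sub
    (hg.tendsto_integral_sub_inf_comap hT u x v hgm hgC)

theorem AsymptEquicontinuous.transition [CompactSpace U]
    (hT : TendstoWeaklyJointly l (fun _ => T) T)
    (u : ι → U) {g : ι → X → ℝ} (hgm : ∀ a, Measurable (g a)) {C : ℝ}
    (hgC : ∀ a x, |g a x| ≤ C) (hg : AsymptEquicontinuous l g) :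
    AsymptEquicontinuous l fun a x => ∫ z, g a z ∂T (x, u a) := by
  intro x
  refine tendsto_of_forall_inf_comap_nhds (fun p => u p.1) fun v => ?_
  have h := hg.tendsto_integral_sub_inf_comap hT u x v hgm hgC
  -- The constraint on the action involves only the index, so freezing the state at `x` respects the
  -- filter, and both integrals are compared with the same limit kernel `T (x, v)`.
  have hx : Tendsto (fun p : ι × X => (p.1, x)) ((l ×ˢ 𝓝 x) ⊓ comap (fun p => u p.1) (𝓝 v))
      ((l ×ˢ 𝓝 x) ⊓ comap (fun p => u p.1) (𝓝 v)) :=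
    tendsto_inf.2 ⟨((tendsto_fst.prodMk tendsto_const_nhds).mono_left inf_le_left),
      tendsto_comap_iff.2 (tendsto_comap.mono_left inf_le_right)⟩
  simpa using h.sub (h.comp hx)

theorem VanishesContinuously.transition [CompactSpace U] [FirstCountableTopology U]
    [l.IsCountablyGenerated] (hS : TendstoWeaklyJointly l S T)
    (u : ι → U) {g : ι → X → ℝ} (hgm : ∀ a, Measurable (g a)) {C : ℝ}
    (hgC : ∀ a x, |g a x| ≤ C) (hg : VanishesContinuously l g) :
    VanishesContinuously l fun a x => ∫ z, g a z ∂S a (x, u a) := by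
  intro x
  refine tendsto_of_forall_inf_comap_nhds (fun p => u p.1) fun v => ?_
  refine VanishesContinuously.tendsto_integral
    (μ := fun p : ι × X => S p.1 (p.2, u p.1)) (ν := T (x, v)) (g := fun p => g p.1)
    (hS.tendsto_inf_comap u x v) (fun p => hgm p.1) (fun p => hgC p.1) fun x' => ?_
  exact (hg x').comp (((tendsto_fst.mono_left inf_le_left).comp tendsto_fst).prodMk tendsto_snd)

end Transition

/-! ### Disintegration of the controlled process -/

section ControlledLaw

variable {X Y U : Type*}

/-- The observations and actions `(Y_0,…,Y_t, U_0,…,U_t)`. -/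
abbrev Record (Y U : Type*) (t : ℕ) : Type _ := (Fin (t + 1) → Y) × (Fin (t + 1) → U)

/-- The observations and actions up to time `t` along a trajectory. -/
def record (t : ℕ) (ω : ℕ → Stage X Y U) : Record Y U t :=
  (fun i => (ω i).1.2, fun i => (ω i).2)

/-- Extension of a record by an observation and an action. -/
def Record.snoc {t : ℕ} (J : Record Y U t) (y : Y) (u : U) : Record Y U (t + 1) :=
  (Fin.snoc (α := fun _ => Y) J.1 y, Fin.snoc (α := fun _ => U) J.2 u)

theorem record_succ (t : ℕ) (ω : ℕ → Stage X Y U) :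
    record (t + 1) ω = (record t ω).snoc (ω (t + 1)).1.2 (ω (t + 1)).2 := by
  refine Prod.ext (funext fun i => ?_) (funext fun i => ?_) <;>
  · induction i using Fin.lastCases with
    | last => simp [record, Record.snoc]
    | cast i => simp [record, Record.snoc]

variable [MeasurableSpace X] [MeasurableSpace Y] [MeasurableSpace U]

/-- Extension of a record by an observation and the action prescribed by a policy. -/
def Policy.nextRecord (γ : Policy Y U) {t : ℕ} (J : Record Y U t) (y : Y) : Record Y U (t + 1) :=
  J.snoc y (γ.act (t + 1) (Fin.snoc (α := fun _ => Y) J.1 y, J.2))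

/-- The record at time `0` after observing `y`. -/
def Policy.initRecord (γ : Policy Y U) (y : Y) : Record Y U 0 :=
  (fun _ => y, fun _ => γ.act 0 (fun _ => y, Fin.elim0))

theorem measurable_finSnoc {A : Type*} [MeasurableSpace A] (t : ℕ) :
    Measurable fun p : (Fin t → A) × A => (Fin.snoc (α := fun _ => A) p.1 p.2 : Fin (t + 1) → A) := by
  refine measurable_pi_iff.2 fun i => ?_
  induction i using Fin.lastCases with
  | last => simpa using measurable_snd
  | cast i => simpa using measurable_fst.eval

theorem measurable_recordSnoc (t : ℕ) :
    Measurable fun p : (Record Y U t × Y) × U => p.1.1.snoc p.1.2 p.2 :=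
  ((measurable_finSnoc (t + 1)).comp (measurable_fst.fst.fst.prodMk measurable_fst.snd)).prodMk
    ((measurable_finSnoc (t + 1)).comp (measurable_fst.fst.snd.prodMk measurable_snd))

theorem Policy.measurable_nextRecord (γ : Policy Y U) (t : ℕ) :
    Measurable fun p : Record Y U t × Y => γ.nextRecord p.1 p.2 :=
  (measurable_recordSnoc t).comp (measurable_id.prodMk ((γ.measurable_act (t + 1)).comp
    (((measurable_finSnoc (t + 1)).comp (measurable_fst.fst.prodMk measurable_snd)).prodMk
      measurable_fst.snd)))

theorem Policy.measurable_initRecord (γ : Policy Y U) : Measurable γ.initRecord :=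
  (measurable_pi_iff.2 fun _ => measurable_id).prodMk (measurable_pi_iff.2 fun _ =>
    (γ.measurable_act 0).comp ((measurable_pi_iff.2 fun _ => measurable_id).prodMk
      measurable_const))

/-- The observations and actions of a history. -/
def History.record {t : ℕ} (h : History X Y U t) : Record Y U t :=
  (fun i => (h.stage i).1.2, fun i => (h.stage i).2)

theorem measurable_historyRecord (t : ℕ) :
    Measurable fun h : History X Y U t => h.record :=
  (measurable_pi_iff.2 fun i => (measurable_stage i).fst.snd).prodMk
    (measurable_pi_iff.2 fun i => (measurable_stage i).snd)

theorem measurable_record (t : ℕ) :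
    Measurable fun ω : ℕ → Stage X Y U => record t ω := by
  unfold record
  fun_prop

theorem trajMeasure_map_eval_zero {S : Type*} [MeasurableSpace S]
    {κ : (n : ℕ) → Kernel (Finset.Iic n → S) S} [∀ n, IsMarkovKernel (κ n)] (μ : Measure S) :
    (Kernel.trajMeasure (X := fun _ => S) μ κ).map (fun ω => ω 0) = μ := by
  have h1 : (Kernel.trajMeasure (X := fun _ => S) μ κ).map (Preorder.frestrictLe 0) =
      μ.map (fun s (_ : Finset.Iic 0) => s) := by
    rw [Kernel.trajMeasure, Measure.map_comp _ _ (by fun_prop), Kernel.traj_map_frestrictLe,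
      Kernel.partialTraj_self, Measure.id_comp]
    refine congrArg (fun e => μ.map e) (funext fun s => funext fun i => ?_)
    rw [Subsingleton.elim i default]
    exact (MeasurableEquiv.piUnique fun _ : Finset.Iic 0 => S).apply_symm_apply s
  have h2 : (fun ω : ℕ → S => ω 0) =
      (fun h : Finset.Iic 0 → S => h ⟨0, by simp⟩) ∘ Preorder.frestrictLe 0 := rfl
  rw [h2, ← Measure.map_map (by fun_prop) (by fun_prop), h1,
    Measure.map_map (by fun_prop) (by fun_prop)]
  exact Measure.map_id

variable {P : Measure X} [IsProbabilityMeasure P] {Q : Kernel X Y} [IsMarkovKernel Q]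
  {T : Kernel (X × U) X} [IsMarkovKernel T]

theorem integral_stepKernel (γ : Policy Y U) (t : ℕ) {F : Stage X Y U → ℝ} (hF : Measurable F)
    {C : ℝ} (hC : ∀ s, |F s| ≤ C) (h : History X Y U t) :
    ∫ s, F s ∂stepKernel Q T γ t h =
      ∫ x, ∫ y, F ((x, y), γ.act (t + 1) (nextInfo t (h, (x, y)))) ∂Q x ∂T h.stateAction := by
  rw [stepKernel, ProbabilityTheory.integral_compProd (integrable_of_abs_le hF hC)]
  have h1 : ∀ p : X × Y, ∫ u, F (p, u) ∂Kernel.deterministic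
      (fun p => γ.act (t + 1) (nextInfo t p))
      ((γ.measurable_act (t + 1)).comp (measurable_nextInfo t)) (h, p)
      = F (p, γ.act (t + 1) (nextInfo t (h, p))) := fun p =>
    Kernel.integral_deterministic' _ (hF.comp (measurable_const.prodMk
      measurable_id)).stronglyMeasurable
  simp only [h1]
  have hm : Measurable fun p : X × Y => F (p, γ.act (t + 1) (nextInfo t (h, p))) :=
    hF.comp (measurable_id.prodMk ((γ.measurable_act (t + 1)).comp
      ((measurable_nextInfo t).comp (measurable_const.prodMk measurable_id))))
  rw [ProbabilityTheory.integral_compProd (integrable_of_abs_le hm fun p => hC _)]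
  simp only [Kernel.comap_apply]

/-- One-step disintegration of the law of the controlled process. -/
theorem integral_processLaw_succ (γ : Policy Y U) (t : ℕ) {f : Record Y U (t + 1) → X → ℝ}
    (hf : Measurable fun p : Record Y U (t + 1) × X => f p.1 p.2) {C : ℝ}
    (hC : ∀ J x, |f J x| ≤ C) :
    ∫ ω, f (record (t + 1) ω) (ω (t + 1)).1.1 ∂processLaw P Q T γ =
      ∫ ω, ∫ x, ∫ y, f (γ.nextRecord (record t ω) y) x ∂Q x
        ∂T ((ω t).1.1, (record t ω).2 (Fin.last t)) ∂processLaw P Q T γ := by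
  let F : History X Y U t × Stage X Y U → ℝ := fun q => f (q.1.record.snoc q.2.1.2 q.2.2) q.2.1.1
  have hFm : Measurable F := hf.comp (((measurable_recordSnoc t).comp
    ((((measurable_historyRecord t).comp measurable_fst).prodMk measurable_snd.fst.snd).prodMk
      measurable_snd.snd)).prodMk measurable_snd.fst.fst)
  have hFC : ∀ q, |F q| ≤ C := fun q => hC _ _
  have hpair : Measurable fun ω : ℕ → Stage X Y U =>
      ((Preorder.frestrictLe t ω : History X Y U t), ω (t + 1)) := by fun_prop
  have hdis := Kernel.map_frestrictLe_trajMeasure_compProd_eq_map_trajMeasure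
    (X := fun _ => Stage X Y U) (μ₀ := initLaw P Q γ) (κ := stepKernel Q T γ) (a := t)
  have hprob : IsProbabilityMeasure ((processLaw P Q T γ).map
      (fun ω => (Preorder.frestrictLe t ω : History X Y U t))) := by
    unfold processLaw
    exact Measure.isProbabilityMeasure_map (by fun_prop)
  calc _ = ∫ ω, F (Preorder.frestrictLe t ω, ω (t + 1)) ∂processLaw P Q T γ := by
        simp only [record_succ]; rfl
    _ = ∫ q, F q ∂((processLaw P Q T γ).map
          fun ω => ((Preorder.frestrictLe t ω : History X Y U t), ω (t + 1))) :=
        (integral_map hpair.aemeasurable hFm.aestronglyMeasurable).symm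
    _ = ∫ q, F q ∂(((processLaw P Q T γ).map
          fun ω => (Preorder.frestrictLe t ω : History X Y U t)).compProd
            (stepKernel Q T γ t)) := by
        rw [processLaw]; exact congrArg (fun m => ∫ q, F q ∂m) hdis.symm
    _ = ∫ h, ∫ s, F (h, s) ∂stepKernel Q T γ t h ∂((processLaw P Q T γ).map
          fun ω => (Preorder.frestrictLe t ω : History X Y U t)) :=
        Measure.integral_compProd (integrable_of_abs_le hFm hFC)
    _ = ∫ ω, ∫ s, F (Preorder.frestrictLe t ω, s) ∂stepKernel Q T γ t (Preorder.frestrictLe t ω)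
          ∂processLaw P Q T γ :=
        integral_map (by fun_prop)
          (hFm.stronglyMeasurable.integral_kernel_prod_right').aestronglyMeasurable
    _ = _ := by
        refine integral_congr_ae (.of_forall fun ω => ?_)
        simp only
        exact integral_stepKernel γ t (F := fun s => F (Preorder.frestrictLe t ω, s))
          (hFm.comp (measurable_const.prodMk measurable_id)) (fun s => hFC _) _

theorem integral_processLaw_zero (γ : Policy Y U) {f : Record Y U 0 → X → ℝ}
    (hf : Measurable fun p : Record Y U 0 × X => f p.1 p.2) {C : ℝ} (hC : ∀ J x, |f J x| ≤ C) :
    ∫ ω, f (record 0 ω) (ω 0).1.1 ∂processLaw P Q T γ =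
      ∫ x, ∫ y, f (γ.initRecord y) x ∂Q x ∂P := by
  let F : Stage X Y U → ℝ := fun s => f (fun _ => s.1.2, fun _ => s.2) s.1.1
  have hFm : Measurable F := hf.comp (((measurable_pi_iff.2 fun _ => measurable_fst.snd).prodMk
    (measurable_pi_iff.2 fun _ => measurable_snd)).prodMk measurable_fst.fst)
  have hFC : ∀ s, |F s| ≤ C := fun s => hC _ _
  have hrec : ∀ ω : ℕ → Stage X Y U, f (record 0 ω) (ω 0).1.1 = F (ω 0) := fun ω => by
    simp only [F, record]
    congr 2 <;> · funext i; rw [Fin.val_eq_zero i]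
  simp only [hrec]
  rw [← integral_map (φ := fun ω : ℕ → Stage X Y U => ω 0)
    (measurable_pi_apply 0).aemeasurable hFm.aestronglyMeasurable,
    processLaw, trajMeasure_map_eval_zero, initLaw,
    Measure.integral_compProd (integrable_of_abs_le hFm hFC)]
  have h1 : ∀ p : X × Y, ∫ u, F (p, u) ∂Kernel.deterministic (fun p => γ.act 0 (initInfo p))
      ((γ.measurable_act 0).comp measurable_initInfo) p = F (p, γ.act 0 (initInfo p)) := fun p =>
    Kernel.integral_deterministic' _ (hFm.comp (measurable_const.prodMk
      measurable_id)).stronglyMeasurable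
  simp only [h1]
  have hm : Measurable fun p : X × Y => F (p, γ.act 0 (initInfo p)) :=
    hFm.comp (measurable_id.prodMk ((γ.measurable_act 0).comp measurable_initInfo))
  rw [Measure.integral_compProd (integrable_of_abs_le hm fun p => hFC _)]
  rfl

end ControlledLaw

/-! ### One-step operators on functions of record and state -/

section Operators

variable {X Y U : Type*} [MeasurableSpace X] [MeasurableSpace Y] [MeasurableSpace U] {t : ℕ}

/-- Integration over the next observation, the next action being prescribed by `γ`. -/
def observationStep (Q : Kernel X Y) (γ : Policy Y U) (f : Record Y U (t + 1) → X → ℝ) :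
    Record Y U t → X → ℝ :=
  fun J x => ∫ y, f (γ.nextRecord J y) x ∂Q x

/-- Integration over the next state. -/
def transitionStep (T : Kernel (X × U) X) (g : Record Y U t → X → ℝ) : Record Y U t → X → ℝ :=
  fun J z => ∫ x, g J x ∂T (z, J.2 (Fin.last t))

/-- A sequence of uniformly bounded measurable functions of the record and the current state. -/
structure IsTestSequence (f : ℕ → Record Y U t → X → ℝ) : Prop where
  measurable : ∀ i, Measurable fun p : Record Y U t × X => f i p.1 p.2
  bounded : ∃ C, ∀ i J x, |f i J x| ≤ C

theorem tendsto_nextRecord (γ : ℕ → Policy Y U) (t : ℕ) :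
    Tendsto (fun p : (ℕ × Record Y U t) × Y => (p.1.1, (γ p.1.1).nextRecord p.1.2 p.2))
      ((atTop ×ˢ ⊤) ×ˢ ⊤) (atTop ×ˢ ⊤) :=
  (tendsto_fst.comp tendsto_fst).prodMk tendsto_top

variable {Q : Kernel X Y} [IsMarkovKernel Q]

theorem IsTestSequence.observationStep {f : ℕ → Record Y U (t + 1) → X → ℝ}
    (hf : IsTestSequence f) (γ : ℕ → Policy Y U) :
    IsTestSequence fun i => observationStep Q (γ i) (f i) where
  measurable i := by
    have hm : Measurable fun q : (Record Y U t × X) × Y =>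
        f i ((γ i).nextRecord q.1.1 q.2) q.1.2 :=
      (hf.measurable i).comp ((((γ i).measurable_nextRecord t).comp
        (measurable_fst.fst.prodMk measurable_snd)).prodMk measurable_fst.snd)
    exact (hm.stronglyMeasurable.integral_kernel_prod_right'
      (κ := Q.comap Prod.snd measurable_snd)).measurable
  bounded := hf.bounded.imp fun _ hC _ _ _ => abs_integral_le_of_abs_le fun _ => hC _ _ _

theorem IsTestSequence.transitionStep {g : ℕ → Record Y U t → X → ℝ} (hg : IsTestSequence g)
    (S : ℕ → Kernel (X × U) X) [∀ i, IsMarkovKernel (S i)] :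
    IsTestSequence fun i => transitionStep (S i) (g i) where
  measurable i := by
    have hm : Measurable fun q : (Record Y U t × X) × X => g i q.1.1 q.2 :=
      (hg.measurable i).comp (measurable_fst.fst.prodMk measurable_snd)
    have hu : Measurable fun p : Record Y U t × X => (p.2, p.1.2 (Fin.last t)) :=
      measurable_snd.prodMk measurable_fst.snd.eval
    exact (hm.stronglyMeasurable.integral_kernel_prod_right'
      (κ := (S i).comap _ hu)).measurable
  bounded := hg.bounded.imp fun _ hC _ _ _ => abs_integral_le_of_abs_le fun _ => hC _ _ _

theorem IsTestSequence.sub {f g : ℕ → Record Y U t → X → ℝ} (hf : IsTestSequence f)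
    (hg : IsTestSequence g) : IsTestSequence fun i J x => f i J x - g i J x where
  measurable i := (hf.measurable i).sub (hg.measurable i)
  bounded := by
    obtain ⟨C, hC⟩ := hf.bounded
    obtain ⟨D, hD⟩ := hg.bounded
    exact ⟨C + D, fun i J x => (abs_sub _ _).trans (add_le_add (hC i J x) (hD i J x))⟩

theorem IsTestSequence.integrable {f : ℕ → Record Y U t → X → ℝ} (hf : IsTestSequence f) (i : ℕ)
    (μ : Measure (ℕ → Stage X Y U)) [IsFiniteMeasure μ] :
    Integrable (fun ω => f i (record t ω) (ω t).1.1) μ := by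
  obtain ⟨C, hC⟩ := hf.bounded
  exact integrable_of_abs_le ((hf.measurable i).comp
    ((measurable_record t).prodMk (measurable_pi_apply t).fst.fst)) fun _ => hC _ _ _

instance (P : Measure X) [IsProbabilityMeasure P] (T : Kernel (X × U) X) [IsMarkovKernel T]
    (γ : Policy Y U) : IsProbabilityMeasure (processLaw P Q T γ) := by
  unfold processLaw; infer_instance

end Operators

/-! ### Backward recursion for expectations -/

section Convergence

variable {X Y U : Type*} [PseudoMetricSpace X] [SecondCountableTopology X] [MeasurableSpace X]
  [BorelSpace X] [MeasurableSpace Y] [TopologicalSpace U] [CompactSpace U]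
  [FirstCountableTopology U] [MeasurableSpace U]
  {P : Measure X} [IsProbabilityMeasure P] {Q : Kernel X Y} [IsMarkovKernel Q]
  {T : Kernel (X × U) X} [IsMarkovKernel T] {Ts : ℕ → Kernel (X × U) X}
  [∀ i, IsMarkovKernel (Ts i)]

/-- Vanishing is only local in the state, and the state laws vary with `i`. Peeling off one stage at
a time preserves the property until only the fixed law `P` remains. -/
theorem tendsto_integral_processLaw_of_vanishesContinuously
    (hTs : ConvergesContinuouslyWeakly Ts T) (γ : ℕ → Policy Y U) (t : ℕ) :
    ∀ {h : ℕ → Record Y U t → X → ℝ}, IsTestSequence h →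
      VanishesContinuously (atTop ×ˢ ⊤) (fun a : ℕ × Record Y U t => h a.1 a.2) →
      Tendsto (fun i => ∫ ω, h i (record t ω) (ω t).1.1 ∂processLaw P Q (Ts i) (γ i)) atTop
        (𝓝 0) := by
  induction t with
  | zero =>
    intro h hh hv
    obtain ⟨C, hC⟩ := hh.bounded
    have h1 : VanishesContinuously atTop fun i x => ∫ y, h i ((γ i).initRecord y) x ∂Q x :=
      hv.integral_channel (Q := Q) (σ := fun i y => (i, (γ i).initRecord y))
        (tendsto_fst.prodMk tendsto_top)
    have hm : ∀ i, Measurable fun x => ∫ y, h i ((γ i).initRecord y) x ∂Q x := fun i => by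
      have : Measurable fun q : X × Y => h i ((γ i).initRecord q.2) q.1 :=
        (hh.measurable i).comp (((γ i).measurable_initRecord.comp measurable_snd).prodMk
          measurable_fst)
      exact this.stronglyMeasurable.integral_kernel_prod_right'.measurable
    have h2 := h1.tendsto_integral (μ := fun _ => P) (fun f => tendsto_const_nhds) hm
      (C := C) fun i x => abs_integral_le_of_abs_le fun y => hC _ _ _
    exact h2.congr fun i => (integral_processLaw_zero (γ i) (hh.measurable i) (hC i)).symm
  | succ t ih =>
    intro h hh hv
    obtain ⟨C, hC⟩ := hh.bounded
    have hg := hh.observationStep (Q := Q) γ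
    have h1 : VanishesContinuously (atTop ×ˢ ⊤) fun (a : ℕ × Record Y U t) =>
        observationStep Q (γ a.1) (h a.1) a.2 :=
      hv.integral_channel (Q := Q)
        (σ := fun (a : ℕ × Record Y U t) y => (a.1, (γ a.1).nextRecord a.2 y))
        (tendsto_nextRecord γ t)
    have h2 := h1.transition (hTs.tendstoWeaklyJointly.comp tendsto_fst)
      (fun a : ℕ × Record Y U t => a.2.2 (Fin.last t))
      (fun a => (hg.measurable a.1).comp (measurable_const.prodMk measurable_id))
      (C := C) (fun a x => abs_integral_le_of_abs_le fun y => hC _ _ _)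
    exact (ih (hg.transitionStep Ts) h2).congr fun i =>
      (integral_processLaw_succ (γ i) t (hh.measurable (i)) (hC i)).symm

theorem tendsto_integral_processLaw_sub (hQ : IsTVContinuous Q) (hT : IsWeaklyContinuous T)
    (hTs : ConvergesContinuouslyWeakly Ts T) (γ : ℕ → Policy Y U) (t : ℕ) :
    ∀ {f : ℕ → Record Y U t → X → ℝ}, IsTestSequence f →
      AsymptEquicontinuous (atTop ×ˢ ⊤) (fun a : ℕ × Record Y U t => f a.1 a.2) →
      Tendsto (fun i => ∫ ω, f i (record t ω) (ω t).1.1 ∂processLaw P Q (Ts i) (γ i) -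
        ∫ ω, f i (record t ω) (ω t).1.1 ∂processLaw P Q T (γ i)) atTop (𝓝 0) := by
  induction t with
  | zero =>
    intro f hf _
    obtain ⟨C, hC⟩ := hf.bounded
    refine tendsto_const_nhds.congr fun i => ?_
    rw [integral_processLaw_zero (γ i) (hf.measurable i) (hC i),
      integral_processLaw_zero (γ i) (hf.measurable i) (hC i), sub_self]
  | succ t ih =>
    intro f hf he
    obtain ⟨C, hC⟩ := hf.bounded
    have hg := hf.observationStep (Q := Q) γ
    have hgm : ∀ a : ℕ × Record Y U t, Measurable (observationStep Q (γ a.1) (f a.1) a.2) :=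
      fun a => (hg.measurable a.1).comp (measurable_const.prodMk measurable_id)
    have hgC : ∀ (a : ℕ × Record Y U t) x, |observationStep Q (γ a.1) (f a.1) a.2 x| ≤ C :=
      fun a x => abs_integral_le_of_abs_le fun y => hC _ _ _
    have h1 : AsymptEquicontinuous (atTop ×ˢ ⊤) fun (a : ℕ × Record Y U t) =>
        observationStep Q (γ a.1) (f a.1) a.2 :=
      he.integral_channel hQ
        (σ := fun (a : ℕ × Record Y U t) y => (a.1, (γ a.1).nextRecord a.2 y))
        (tendsto_nextRecord γ t)
        (fun a x => (hf.measurable a.1).comp ((((γ a.1).measurable_nextRecord t).comp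
          (measurable_const.prodMk measurable_id)).prodMk measurable_const))
        (fun b x => hC _ _ _)
    have h2 := h1.transition_sub (hTs.tendstoWeaklyJointly.comp tendsto_fst)
      (hT.tendstoWeaklyJointly _) (fun a : ℕ × Record Y U t => a.2.2 (Fin.last t)) hgm hgC
    have h3 := h1.transition (hT.tendstoWeaklyJointly _)
      (fun a : ℕ × Record Y U t => a.2.2 (Fin.last t)) hgm hgC
    have hs := hg.transitionStep Ts
    have ht := hg.transitionStep fun _ => T
    -- Telescoping: under the `Ts i` law, the last transition is first switched to `T`, with
    -- vanishing error; the remaining difference has the same integrand under both laws and falls to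
    -- the induction hypothesis.
    have h4 := (tendsto_integral_processLaw_of_vanishesContinuously (P := P) (Q := Q) hTs γ t
      (hs.sub ht) h2).add (ih ht h3)
    rw [add_zero] at h4
    refine h4.congr fun i => ?_
    rw [integral_sub (hs.integrable i _) (ht.integrable i _),
      integral_processLaw_succ (γ i) t (hf.measurable i) (hC i),
      integral_processLaw_succ (γ i) t (hf.measurable i) (hC i), sub_add_sub_cancel]
    rfl

end Convergence

/-! ### Stage costs and the discounted series -/

section Cost

/-- Compactness of `U` lets the actions be assumed to converge to some `v`; both cost terms then
tend to `c x v`. -/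
theorem asymptEquicontinuous_cost {X U : Type*} [TopologicalSpace X] [TopologicalSpace U]
    [CompactSpace U] {c : X → U → ℝ} (hc : Continuous fun p : X × U => c p.1 p.2) {ι : Type*}
    (l : Filter ι) (u : ι → U) : AsymptEquicontinuous l fun a x => c x (u a) := by
  intro x
  refine tendsto_of_forall_inf_comap_nhds (fun p => u p.1) fun v => ?_
  have hu : Tendsto (fun p : ι × X => u p.1) ((l ×ˢ 𝓝 x) ⊓ comap (fun p => u p.1) (𝓝 v)) (𝓝 v) :=
    tendsto_comap.mono_left inf_le_right
  have h1 := (hc.tendsto (x, v)).comp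
    ((tendsto_snd.mono_left (inf_le_left (b := comap (fun p : ι × X => u p.1) (𝓝 v)))).prodMk_nhds hu)
  have h2 := (hc.tendsto (x, v)).comp ((tendsto_const_nhds (x := x)).prodMk_nhds hu)
  simpa using h1.sub h2

variable {X Y U : Type*} [MeasurableSpace X] [MeasurableSpace Y] [MeasurableSpace U]
  {P : Measure X} [IsProbabilityMeasure P] {Q : Kernel X Y} [IsMarkovKernel Q]
  {β : ℝ} {c : X → U → ℝ}

theorem discountedCost_eq_tsum (hβ : β ∈ Set.Ioo (0 : ℝ) 1)
    (hcm : Measurable fun p : X × U => c p.1 p.2) {C : ℝ} (hC : ∀ x u, |c x u| ≤ C)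
    (T : Kernel (X × U) X) [IsMarkovKernel T] (γ : Policy Y U) :
    discountedCost β c P Q T γ =
      ∑' t : ℕ, β ^ t * ∫ ω, c (ω t).1.1 (ω t).2 ∂processLaw P Q T γ := by
  have hm : ∀ t, Measurable fun ω : ℕ → Stage X Y U => c (ω t).1.1 (ω t).2 := fun t =>
    hcm.comp ((measurable_pi_apply t).fst.fst.prodMk (measurable_pi_apply t).snd)
  have hi : ∀ t, Integrable (fun ω : ℕ → Stage X Y U => c (ω t).1.1 (ω t).2)
      (processLaw P Q T γ) := fun t => integrable_of_abs_le (hm t) fun _ => hC _ _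
  rw [discountedCost, ← integral_tsum_of_summable_integral_norm (fun t => (hi t).const_mul _)]
  · simp only [integral_const_mul]
  · refine Summable.of_nonneg_of_le (fun t => integral_nonneg fun _ => norm_nonneg _)
      (fun t => ?_) ((summable_geometric_of_lt_one hβ.1.le hβ.2).mul_right C)
    have hb : ∀ ω : ℕ → Stage X Y U, ‖β ^ t * c (ω t).1.1 (ω t).2‖ ≤ β ^ t * C := fun ω => by
      rw [norm_mul, Real.norm_of_nonneg (pow_nonneg hβ.1.le t)]
      exact mul_le_mul_of_nonneg_left (hC _ _) (pow_nonneg hβ.1.le t)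
    exact (le_abs_self _).trans (abs_integral_le_of_abs_le fun ω => by
      rw [abs_norm]; exact hb ω)

end Cost

/-! ### Asymptotic optimality -/

section Robustness

variable {X Y U : Type*} [PseudoMetricSpace X] [SecondCountableTopology X] [MeasurableSpace X]
  [BorelSpace X] [MeasurableSpace Y] [TopologicalSpace U] [CompactSpace U]
  [FirstCountableTopology U] [MeasurableSpace U]
  {P : Measure X} [IsProbabilityMeasure P] {Q : Kernel X Y} [IsMarkovKernel Q]
  {T : Kernel (X × U) X} [IsMarkovKernel T] {Ts : ℕ → Kernel (X × U) X}
  [∀ i, IsMarkovKernel (Ts i)] {β : ℝ} {c : X → U → ℝ}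

/-- The discounted costs of any sequence of policies in the models `Ts i` and `T` are
asymptotically equal. -/
theorem tendsto_discountedCost_sub (hβ : β ∈ Set.Ioo (0 : ℝ) 1)
    (hcm : Measurable fun p : X × U => c p.1 p.2) {C : ℝ} (hC : ∀ x u, |c x u| ≤ C)
    (hc : Continuous fun p : X × U => c p.1 p.2) (hQ : IsTVContinuous Q)
    (hT : IsWeaklyContinuous T) (hTs : ConvergesContinuouslyWeakly Ts T) (γ : ℕ → Policy Y U) :
    Tendsto (fun i => discountedCost β c P Q (Ts i) (γ i) - discountedCost β c P Q T (γ i)) atTop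
      (𝓝 0) := by
  have hterm : ∀ t, Tendsto (fun i => ∫ ω, c (ω t).1.1 (ω t).2 ∂processLaw P Q (Ts i) (γ i) -
      ∫ ω, c (ω t).1.1 (ω t).2 ∂processLaw P Q T (γ i)) atTop (𝓝 0) := fun t =>
    tendsto_integral_processLaw_sub hQ hT hTs γ t
      (f := fun _ J x => c x (J.2 (Fin.last t)))
      ⟨fun _ => hcm.comp (measurable_snd.prodMk measurable_fst.snd.eval), C, fun _ _ _ => hC _ _⟩
      (asymptEquicontinuous_cost hc _ _)
  have hb : ∀ (S : Kernel (X × U) X) [IsMarkovKernel S] (γ : Policy Y U) (t : ℕ),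
      |∫ ω, c (ω t).1.1 (ω t).2 ∂processLaw P Q S γ| ≤ C :=
    fun S _ γ t => abs_integral_le_of_abs_le fun _ => hC _ _
  have hsum : ∀ (S : Kernel (X × U) X) [IsMarkovKernel S] (γ : Policy Y U),
      Summable fun t : ℕ => β ^ t * ∫ ω, c (ω t).1.1 (ω t).2 ∂processLaw P Q S γ := fun S _ γ => by
    refine Summable.of_norm_bounded
      ((summable_geometric_of_lt_one hβ.1.le hβ.2).mul_right C) fun t => ?_
    rw [norm_mul, Real.norm_of_nonneg (pow_nonneg hβ.1.le t)]
    exact mul_le_mul_of_nonneg_left (hb S γ t) (pow_nonneg hβ.1.le t)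
  have h := tendsto_tsum_of_dominated_convergence (𝓕 := atTop)
    (f := fun (i : ℕ) (t : ℕ) => β ^ t * (∫ ω, c (ω t).1.1 (ω t).2 ∂processLaw P Q (Ts i) (γ i) -
      ∫ ω, c (ω t).1.1 (ω t).2 ∂processLaw P Q T (γ i))) (g := fun _ => (0 : ℝ))
    (bound := fun t => β ^ t * (C + C))
    ((summable_geometric_of_lt_one hβ.1.le hβ.2).mul_right _)
    (fun t => by simpa using (hterm t).const_mul (β ^ t))
    (.of_forall fun i t => by
      rw [norm_mul, Real.norm_of_nonneg (pow_nonneg hβ.1.le t)]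
      exact mul_le_mul_of_nonneg_left ((abs_sub _ _).trans (add_le_add (hb _ _ t) (hb _ _ t)))
        (pow_nonneg hβ.1.le t))
  rw [tsum_zero] at h
  refine h.congr fun i => ?_
  rw [discountedCost_eq_tsum hβ hcm hC, discountedCost_eq_tsum hβ hcm hC,
    ← (hsum (Ts i) (γ i)).tsum_sub (hsum T (γ i))]
  simp only [mul_sub]

/-- Policies that are optimal for the models `Ts i` are asymptotically optimal for `T`. -/
theorem tendsto_abs_discountedCost_sub_optimalCost (hβ : β ∈ Set.Ioo (0 : ℝ) 1)
    (hcm : Measurable fun p : X × U => c p.1 p.2) (hc0 : ∀ x u, 0 ≤ c x u) {C : ℝ}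
    (hC : ∀ x u, c x u ≤ C)
    (hc : Continuous fun p : X × U => c p.1 p.2) (hQ : IsTVContinuous Q)
    (hT : IsWeaklyContinuous T) (hTs : ConvergesContinuouslyWeakly Ts T) (γs : ℕ → Policy Y U)
    (hγs : ∀ i, IsOptimalPolicy β c P Q (Ts i) (γs i)) :
    Tendsto (fun i => |discountedCost β c P Q T (γs i) - optimalCost β c P Q T|) atTop (𝓝 0) := by
  have hC' : ∀ x u, |c x u| ≤ C := fun x u => by rw [abs_of_nonneg (hc0 x u)]; exact hC x u
  have hJ0 : ∀ (S : Kernel (X × U) X) [IsMarkovKernel S] (γ : Policy Y U),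
      0 ≤ discountedCost β c P Q S γ := fun S _ γ =>
    integral_nonneg fun ω => tsum_nonneg fun t => mul_nonneg (pow_nonneg hβ.1.le t) (hc0 _ _)
  have hbdd : ∀ (S : Kernel (X × U) X) [IsMarkovKernel S],
      BddBelow (Set.range fun γ : Policy Y U => discountedCost β c P Q S γ) := fun S _ =>
    ⟨0, by rintro _ ⟨γ, rfl⟩; exact hJ0 S γ⟩
  have hconv := fun γ : ℕ → Policy Y U =>
    tendsto_discountedCost_sub (P := P) hβ hcm hC' hc hQ hT hTs γ
  rw [Metric.tendsto_nhds]
  intro ε hε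
  have : Nonempty (Policy Y U) := ⟨γs 0⟩
  -- The infimum need not be attained, so a policy within `ε / 3` of it is used; the other two
  -- thirds pay for changing models along `γs` and along the constant sequence `γ'`.
  obtain ⟨γ', hγ'⟩ := exists_lt_of_ciInf_lt
    (show ⨅ γ : Policy Y U, discountedCost β c P Q T γ < optimalCost β c P Q T + ε / 3 by
      rw [optimalCost]; linarith)
  have hε3 : 0 < ε / 3 := by positivity
  filter_upwards [(Metric.tendsto_nhds.1 (hconv γs)) _ hε3,
    (Metric.tendsto_nhds.1 (hconv fun _ => γ')) _ hε3] with i h1 h2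
  rw [Real.dist_eq, sub_zero] at h1 h2
  have h3 : optimalCost β c P Q T ≤ discountedCost β c P Q T (γs i) := ciInf_le (hbdd T) _
  have h4 : discountedCost β c P Q (Ts i) (γs i) ≤ discountedCost β c P Q (Ts i) γ' := by
    rw [hγs i]; exact ciInf_le (hbdd (Ts i)) _
  rw [Real.dist_eq, sub_zero, abs_abs, abs_of_nonneg (sub_nonneg.2 h3)]
  linarith [(abs_lt.1 h1).1, (abs_lt.1 h2).2]

end Robustness

end RobustPOMDP

end

theorem mainTheorem5 {m n k : ℕ}
    (X : Set (EuclideanSpace ℝ (Fin m))) (hX : MeasurableSet X)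
    (Y : Set (EuclideanSpace ℝ (Fin n))) (hY : MeasurableSet Y)
    (U : Set (EuclideanSpace ℝ (Fin k))) (hU : IsCompact U)
    (β : ℝ) (hβ : β ∈ Set.Ioo (0 : ℝ) 1)
    (c : X → U → ℝ) (hc_nonneg : ∀ x u, 0 ≤ c x u) (hc_bdd : ∃ C : ℝ, ∀ x u, c x u ≤ C)
    (hc_cont : Continuous fun p : X × U => c p.1 p.2)
    (P : Measure X) [IsProbabilityMeasure P]
    (Q : Kernel X Y) [IsMarkovKernel Q] (hQ : RobustPOMDP.IsTVContinuous Q)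
    (T : Kernel (X × U) X) [IsMarkovKernel T] (hT : RobustPOMDP.IsWeaklyContinuous T)
    (Ts : ℕ → Kernel (X × U) X) [∀ i, IsMarkovKernel (Ts i)]
    (hTs : RobustPOMDP.ConvergesContinuouslyWeakly Ts T)
    (γs : ℕ → RobustPOMDP.Policy Y U)
    (hγs : ∀ i, RobustPOMDP.IsOptimalPolicy β c P Q (Ts i) (γs i)) :
    Tendsto (fun i => |RobustPOMDP.discountedCost β c P Q T (γs i)
      - RobustPOMDP.optimalCost β c P Q T|) atTop (𝓝 0) := by
  have : CompactSpace U := isCompact_iff_compactSpace.1 hU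
  obtain ⟨C, hC⟩ := hc_bdd
  exact RobustPOMDP.tendsto_abs_discountedCost_sub_optimalCost hβ hc_cont.measurable hc_nonneg hC
    hc_cont hQ hT hTs γs hγs
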